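/- **Lemma.** Let $\Theta\in\mathbb R^{n\times n}$ be antisymmetric and non-singular, and let $X=(X_1,\dots,X_n)^{\mathrm T}$ be self-adjoint operators on a complex Hilbert space $\mathcal H$ satisfying the canonical commutation relations $[X,X^{\mathrm T}]=2i\Theta$ in the following sense: there is a dense subspace $\mathcal D$, contained in the domain of every $X_j$ and mapped into itself by every $X_j$, such that $(X_jX_k-X_kX_j)\varphi=2i\Theta_{jk}\varphi$ and $\sum_{m\ge 0}\frac{t^m}{m!}\|(\lambda^{\mathrm T}X)^m\varphi\|<\infty$ for all $\varphi\in\mathcal D$, $j,k\le n$, $\lambda\in\mathbb R^n$, $t\ge0$. For $\lambda\in\mathbb R^n$ let $\lambda^{\mathrm T}X$ denote the closure of $\sum_j\lambda_jX_j$ on $\bigcap_j\operatorname{dom}X_j$, and let $e^{i\lambda^{\mathrm T}X}$ be the value at time $1$ of the strongly continuous unitary group that it generates. Let $\mu$ be a measure on $\mathbb R^n$ that is invariant under $\lambda\mapsto-\lambda$ (for example the Lebesgue measure, $d\mu(\lambda)=d\lambda$), and let $h:\mathbb R^n\to\mathbb C$ satisfy $h(-\lambda)=\overline{h(\lambda)}$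 for all $\lambda$, with $h$ and $|\lambda|\,|h(\lambda)|$ integrable with respect to $\mu$. Operator-valued integrals $\int g(\lambda)e^{i\lambda^{\mathrm T}X}\,d\mu(\lambda)$ are understood strongly: they map $\varphi$ to the Bochner integral $\int g(\lambda)e^{i\lambda^{\mathrm T}X}\varphi\,d\mu(\lambda)$. Products and sums of operators have their natural domains. Then: 1. $e^{i\lambda^{\mathrm T}X}\,X_j\,e^{-i\lambda^{\mathrm T}X}=X_j+2(\Theta\lambda)_j$, with equality of domains, for every $\lambda\in\mathbb R^n$ and every $j$. 2. The Weyl-quantized perturbation $H_1=\int h(\lambda)e^{i\lambda^{\mathrm T}X}\,d\mu(\lambda)$ is an everywhere defined self-adjoint operator. 3. For every $j$, the entry $Z_j=i[H_1,X_j]$ of the drift perturbation has domain $\operatorname{dom}X_j$; the $j$-th entry of $2i\Theta\int h(\lambda)\,\lambda\, e^{i\lambda^{\mathrm T}X}\,d\mu(\lambda)$ is everywhere defined; the two agree on $\operatorname{dom}X_j$; and the latter is the closure of $Z_j$. In this sense $$Z=i[H_1,X]=2i\Theta\int h(\lambda)\,\lambda\, e^{i\lambda^{\mathrm T}X}\,d\mu(\lambda).$$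 -/

import Mathlib

open MeasureTheory

namespace CCR

variable {F : Type*} [NormedAddCommGroup F] [InnerProductSpace ℂ F] {n : ℕ}

/-- The product `A B` of two partially defined operators, on its natural domain
`{φ ∈ dom B | B φ ∈ dom A}`. -/
def mul (A B : F →ₗ.[ℂ] F) : F →ₗ.[ℂ] F where
  domain := (A.domain.comap B.toFun).map B.domain.subtype
  toFun :=
    have hB : ∀ φ : (A.domain.comap B.toFun).map B.domain.subtype, (φ : F) ∈ B.domain := by
      rintro ⟨_, x, -, rfl⟩; exact x.2
    have hA : ∀ φ : (A.domain.comap B.toFun).map B.domain.subtype, B ⟨φ, hB φ⟩ ∈ A.domain := by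
      rintro ⟨_, x, hx, rfl⟩; exact hx
    { toFun := fun φ => A ⟨B ⟨φ, hB φ⟩, hA φ⟩
      map_add' := fun φ ψ => by
        rw [← LinearPMap.map_add]
        exact congrArg A (Subtype.ext (B.map_add ⟨φ, hB φ⟩ ⟨ψ, hB ψ⟩))
      map_smul' := fun c φ => by
        rw [RingHom.id_apply, ← LinearPMap.map_smul]
        exact congrArg A (Subtype.ext (B.map_smul c ⟨φ, hB φ⟩)) }

theorem mul_apply (A B : F →ₗ.[ℂ] F) (φ : F) (h : φ ∈ B.domain) (h' : B ⟨φ, h⟩ ∈ A.domain)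
    (h'' : φ ∈ (mul A B).domain) : mul A B ⟨φ, h''⟩ = A ⟨B ⟨φ, h⟩, h'⟩ := rfl

theorem mem_mul_domain (A B : F →ₗ.[ℂ] F) (φ : F) :
    φ ∈ (mul A B).domain ↔ ∃ h : φ ∈ B.domain, B ⟨φ, h⟩ ∈ A.domain := by
  constructor
  · rintro ⟨x, hx, rfl⟩
    exact ⟨x.2, hx⟩
  · rintro ⟨h, h'⟩
    exact ⟨⟨φ, h⟩, h', rfl⟩

/-- The commutator `[A, B] = A B - B A`, on the natural domain `dom (A B) ∩ dom (B A)`. -/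
def comm (A B : F →ₗ.[ℂ] F) : F →ₗ.[ℂ] F := mul A B - mul B A

/-- An everywhere defined bounded operator, as a partially defined operator. -/
def ofCLM (T : F →L[ℂ] F) : F →ₗ.[ℂ] F := (T : F →ₗ[ℂ] F).toPMap ⊤

/-- The multiple `c I` of the identity operator. -/
def scalar (c : ℂ) : F →ₗ.[ℂ] F := ofCLM (c • ContinuousLinearMap.id ℂ F)

/-- `V` is the strongly continuous one-parameter unitary group with generator `A`, that is,
`V t = exp (i t A)`: the vectors `φ` at which `t ↦ V t φ` is differentiable are exactly those in the
domain of `A`, and the derivative at `0` is `i A φ`. -/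
structure IsUnitaryGroup [CompleteSpace F] (A : F →ₗ.[ℂ] F) (V : ℝ → F →L[ℂ] F) : Prop where
  unitary : ∀ t, V t ∈ unitary (F →L[ℂ] F)
  zero : V 0 = 1
  add : ∀ s t, V (s + t) = V s * V t
  continuous : ∀ φ, Continuous fun t => V t φ
  generator : ∀ φ ψ : F,
    (φ, ψ) ∈ A.graph ↔ HasDerivAt (fun t => V t φ) (Complex.I • ψ) 0

/-- A unitary group maps the domain of its generator `A` into itself and solves `u' = i A u`. -/
theorem IsUnitaryGroup.hasDerivAt [CompleteSpace F] {A : F →ₗ.[ℂ] F} {V : ℝ → F →L[ℂ] F}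
    (hV : IsUnitaryGroup A V) {φ ψ : F} (h : (φ, ψ) ∈ A.graph) (t : ℝ) :
    (V t φ, V t ψ) ∈ A.graph ∧ HasDerivAt (fun s => V s φ) (Complex.I • V t ψ) t := by
  have h0 := (hV.generator φ ψ).1 h
  have h1 : HasDerivAt (fun s => V t (V s φ)) (V t (Complex.I • ψ)) 0 :=
    ((V t).restrictScalars ℝ).hasFDerivAt.comp_hasDerivAt 0 h0
  have h2 : ∀ s, V t (V s φ) = V (s + t) φ := fun s => by rw [add_comm, hV.add]; rfl
  have h3 : ∀ s, V (s + t) φ = V s (V t φ) := fun s => by rw [hV.add]; rfl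
  rw [map_smul] at h1
  constructor
  · rw [hV.generator]
    simpa only [h2, h3] using h1
  · simp only [h2] at h1
    have h4 : HasDerivAt (fun s => V (s + t) φ) (Complex.I • V t ψ) (t - t) := by
      rwa [sub_self]
    simpa using h4.comp_sub_const t t

/-- A self-adjoint operator generates at most one unitary group. -/
theorem IsUnitaryGroup.unique [CompleteSpace F] {A : F →ₗ.[ℂ] F} (hA : IsSelfAdjoint A)
    {V W : ℝ → F →L[ℂ] F} (hV : IsUnitaryGroup A V) (hW : IsUnitaryGroup A W) : V = W := by
  have hinner : ∀ (t : ℝ) (φ ψ : F), inner ℂ (V t φ) (V t ψ) = inner ℂ φ ψ := fun t φ ψ => by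
    rw [← ContinuousLinearMap.adjoint_inner_right, ← mul_apply_eq_comp,
      ← ContinuousLinearMap.star_eq_adjoint, Unitary.star_mul_self_of_mem (hV.unitary t),
      one_apply_eq_self]
  have hsymm : ∀ {a a' b b' : F}, (a, a') ∈ A.graph → (b, b') ∈ A.graph →
      inner ℂ a' b = inner ℂ a b' := fun {a a' b b'} ha hb => by
    obtain ⟨y, hy, hy'⟩ := (LinearPMap.mem_graph_iff A).1 ha
    obtain ⟨z, hz, hz'⟩ := (LinearPMap.mem_graph_iff A).1 hb
    have := LinearPMap.adjoint_isFormalAdjoint hA.dense_domain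
    rw [LinearPMap.isSelfAdjoint_def.1 hA] at this
    simp only at hy hy' hz hz'
    rw [← hy, ← hy', ← hz, ← hz']
    exact this y z
  have key : ∀ (φ ψ : A.domain) (t : ℝ), inner ℂ (V t φ) (W t ψ) = inner ℂ (φ : F) (ψ : F) := by
    intro φ ψ t
    have hd : ∀ s, HasDerivAt (fun s => inner ℂ (V s φ) (W s ψ)) (0 : ℂ) s := fun s => by
      obtain ⟨a1, a2⟩ := hV.hasDerivAt (A.mem_graph φ) s
      obtain ⟨b1, b2⟩ := hW.hasDerivAt (A.mem_graph ψ) s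
      have h0 : inner ℂ (V s φ) (Complex.I • W s (A ψ)) +
          inner ℂ (Complex.I • V s (A φ)) (W s ψ) = 0 := by
        rw [inner_smul_left, inner_smul_right, hsymm a1 b1]
        simp
      exact h0 ▸ HasDerivAt.inner ℂ a2 b2
    have := is_const_of_deriv_eq_zero (fun s => (hd s).differentiableAt)
      (fun s => (hd s).deriv) t 0
    simpa [hV.zero, hW.zero] using this
  funext t
  refine ContinuousLinearMap.ext fun ψ => ?_
  have hd := hA.dense_domain
  refine hd.induction (P := fun ψ => V t ψ = W t ψ) (fun ψ hψ => ?_)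
    (isClosed_eq (V t).continuous (W t).continuous) ψ
  have hz : ∀ φ : F, inner ℂ (V t φ) (V t ψ - W t ψ) = 0 := fun φ => by
    refine hd.induction (P := fun φ => inner ℂ (V t φ) (V t ψ - W t ψ) = 0) (fun φ hφ => ?_)
      (isClosed_eq (by fun_prop) (by fun_prop)) φ
    rw [inner_sub_right, hinner, key ⟨φ, hφ⟩ ⟨ψ, hψ⟩ t, sub_self]
  have hs : V t (V (-t) (V t ψ - W t ψ)) = V t ψ - W t ψ := by
    rw [← mul_apply_eq_comp, ← hV.add, add_neg_cancel, hV.zero]; rfl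
  have := hz (V (-t) (V t ψ - W t ψ))
  rw [hs, inner_self_eq_zero, sub_eq_zero] at this
  exact this

open Classical in
/-- The unitary operator `exp (i A)` of a self-adjoint operator `A`: the value at time `1` of the
unitary group generated by `A`. -/
noncomputable def expI [CompleteSpace F] (A : F →ₗ.[ℂ] F) : F →L[ℂ] F :=
  if h : ∃ V : ℝ → F →L[ℂ] F, IsUnitaryGroup A V then h.choose 1 else 0

/-- The operator `lᵀ X = ∑ⱼ lⱼ Xⱼ`: the closure of the sum on the common domain of the `Xⱼ`. -/
noncomputable def linForm (X : Fin n → F →ₗ.[ℂ] F) (l : EuclideanSpace ℝ (Fin n)) : F →ₗ.[ℂ] F :=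
  (∑ j, (l j : ℂ) • X j).closure

/-- The unitary operator `exp (i lᵀ X)`. -/
noncomputable def weylUnitary [CompleteSpace F] (X : Fin n → F →ₗ.[ℂ] F)
    (l : EuclideanSpace ℝ (Fin n)) : F →L[ℂ] F :=
  expI (linForm X l)

/-- The Heisenberg commutation relations `[Xⱼ, Xₖ] = 2 i Θⱼₖ` on a common invariant domain `D`, on
which the `Xⱼ` act as the endomorphisms `x j`; moreover the exponential series of every `i t lᵀ X`
converges absolutely on `D`. -/
structure IsCCRDomain (Θ : Matrix (Fin n) (Fin n) ℝ) (X : Fin n → F →ₗ.[ℂ] F)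
    (D : Submodule ℂ F) (x : Fin n → Module.End ℂ D) : Prop where
  dense : Dense (D : Set F)
  graph : ∀ j (φ : D), ((φ : F), (x j φ : F)) ∈ (X j).graph
  ccr : ∀ j k, x j * x k - x k * x j = (2 * Complex.I * (Θ j k : ℂ)) • (1 : Module.End ℂ D)
  summable : ∀ (l : EuclideanSpace ℝ (Fin n)) (φ : D) (t : ℝ),
    Summable fun m : ℕ => t ^ m / (m.factorial : ℝ) * ‖((∑ j, (l j : ℂ) • x j) ^ m) φ‖

/-- The self-adjoint operators `X₁, …, Xₙ` satisfy the canonical commutation relations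
`[X, Xᵀ] = 2 i Θ`. -/
def IsCCR [CompleteSpace F] (Θ : Matrix (Fin n) (Fin n) ℝ) (X : Fin n → F →ₗ.[ℂ] F) : Prop :=
  (∀ j, IsSelfAdjoint (X j)) ∧
    ∃ (D : Submodule ℂ F) (x : Fin n → Module.End ℂ D), IsCCRDomain Θ X D x

/-- The operator `∫ g(l) exp (i lᵀ X) dμ(l)`, understood in the strong sense: it maps `φ` to the
Bochner integral `∫ g(l) exp (i lᵀ X) φ dμ(l)` whenever that converges. -/
noncomputable def weylInt [CompleteSpace F] (X : Fin n → F →ₗ.[ℂ] F)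
    (μ : Measure (EuclideanSpace ℝ (Fin n))) (g : EuclideanSpace ℝ (Fin n) → ℂ) :
    F →ₗ.[ℂ] F where
  domain :=
    { carrier := {φ | Integrable (fun l => g l • weylUnitary X l φ) μ}
      zero_mem' := by simp
      add_mem' := fun {φ ψ} hφ hψ => by
        change Integrable (fun l => g l • weylUnitary X l (φ + ψ)) μ
        simp only [map_add, smul_add]
        exact Integrable.add hφ hψ
      smul_mem' := fun c φ hφ => by
        change Integrable (fun l => g l • weylUnitary X l (c • φ)) μ
        simp only [map_smul, smul_comm _ c]
        exact Integrable.smul c hφ }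
  toFun :=
    { toFun := fun φ => ∫ l, g l • weylUnitary X l (φ : F) ∂μ
      map_add' := fun φ ψ => by
        simp only [Submodule.coe_add, map_add, smul_add]
        exact integral_add φ.2 ψ.2
      map_smul' := fun c φ => by
        simp only [Submodule.coe_smul, map_smul, smul_comm _ c, RingHom.id_apply]
        exact integral_smul c _ }

/-- The `j`-th entry `Zⱼ = i [H, Xⱼ]` of the drift term which the Hamiltonian `H` generates. -/
noncomputable def drift (H : F →ₗ.[ℂ] F) (X : Fin n → F →ₗ.[ℂ] F) (j : Fin n) : F →ₗ.[ℂ] F :=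
  Complex.I • comm H (X j)

/-- The `j`-th entry of the operator vector `2 i Θ ∫ h(l) l exp (i lᵀ X) dμ(l)`. -/
noncomputable def driftInt [CompleteSpace F] (Θ : Matrix (Fin n) (Fin n) ℝ)
    (X : Fin n → F →ₗ.[ℂ] F) (μ : Measure (EuclideanSpace ℝ (Fin n)))
    (h : EuclideanSpace ℝ (Fin n) → ℂ) (j : Fin n) : F →ₗ.[ℂ] F :=
  (2 * Complex.I) • ∑ k, (Θ j k : ℂ) • weylInt X μ (fun l => h l * (l k : ℂ))

end CCR

namespace CCR

open Filter Topology Complex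

local notation "⟪" a "," b "⟫" => inner ℂ a b

/-! ### Symmetric relations and graphs of partially defined operators. -/

section SymmetricGraph

variable {F : Type*} [NormedAddCommGroup F] [InnerProductSpace ℂ F]

/-! Domain questions are settled by working with graphs. On the invariant domain `D` let `y = ∑ lⱼ
xⱼ`. The exponential series of `i t y` converges on `D`, conserves inner products, and so extends to
a unitary group. Boundedness of these orbits forces `y + i` to have dense range; hence every
symmetric relation extending `y` lies in the closure of its graph (`IsEntire.le_endGraph`). This
identifies `lᵀ X` and each `Xⱼ` with closures of their restrictions to `D`, and `exp (i lᵀ X)` with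
the sum of the series.

Since `[xⱼ, y]` is a scalar, it passes through the series term by term and gives the translation of
`Xⱼ` on `D`; closing the graph gives it on all of `dom Xⱼ` (`IsCCR.weylUnitary_mem_graph`), and
using both `l` and `-l` gives equality of domains.

The integrals are bounded operators because the Weyl unitaries are isometric, and `l ↦ -l` makes
`H₁` symmetric. Testing against `dom Xⱼ` shows that `H₁` preserves this domain
(`IsCCR.integral_mem_graph`). The commutator then equals the drift integral on a dense domain, and
boundedness yields the closure. -/

/-- A linear relation is symmetric if `⟪a', b⟫ = ⟪a, b'⟫` for any two of its pairs `(a, a')` and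
`(b, b')`. -/
def IsSymmGraph (T : Submodule ℂ (F × F)) : Prop :=
  ∀ p ∈ T, ∀ q ∈ T, ⟪p.2, q.1⟫ = ⟪p.1, q.2⟫

theorem isSymmGraph_of_isSelfAdjoint [CompleteSpace F] {A : F →ₗ.[ℂ] F} (hA : IsSelfAdjoint A) :
    IsSymmGraph A.graph := by
  intro p hp q hq
  obtain ⟨y, hy, hy'⟩ := (LinearPMap.mem_graph_iff A).1 hp
  obtain ⟨z, hz, hz'⟩ := (LinearPMap.mem_graph_iff A).1 hq
  have := LinearPMap.adjoint_isFormalAdjoint hA.dense_domain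
  rw [LinearPMap.isSelfAdjoint_def.1 hA] at this
  rw [← hy, ← hy', ← hz, ← hz']
  exact this y z

/-- The graph of a self-adjoint operator consists of the pairs that are symmetric with respect to
it. -/
theorem mem_graph_of_isSelfAdjoint [CompleteSpace F] {A : F →ₗ.[ℂ] F} (hA : IsSelfAdjoint A)
    {φ ψ : F} (h : ∀ p ∈ A.graph, ⟪p.2, φ⟫ = ⟪p.1, ψ⟫) : (φ, ψ) ∈ A.graph := by
  have := LinearPMap.adjoint_graph_eq_graph_adjoint hA.dense_domain
  rw [LinearPMap.isSelfAdjoint_def.1 hA] at this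
  rw [this, Submodule.mem_adjoint_iff]
  intro a b hab
  exact sub_eq_zero.2 (h _ hab)

/-- Symmetry makes `⟪b, a⟫` real, so the cross term vanishes. Thus a bound on `b + i a` controls
both components. -/
theorem IsSymmGraph.norm_sq {T : Submodule ℂ (F × F)} (hT : IsSymmGraph T) {a b : F}
    (h : (a, b) ∈ T) : ‖b + I • a‖ ^ 2 = ‖b‖ ^ 2 + ‖a‖ ^ 2 := by
  have h1 : ⟪b, a⟫ = ⟪a, b⟫ := hT _ h _ h
  have h2 : (⟪b, a⟫).im = 0 := by
    rw [← Complex.conj_eq_iff_im, inner_conj_symm, h1]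
  rw [norm_add_sq (𝕜 := ℂ), inner_smul_right, norm_smul]
  simp [h2]

theorem mk_mem_graph_iff {A : F →ₗ.[ℂ] F} {φ ψ : F} :
    (φ, ψ) ∈ A.graph ↔ ∃ h : φ ∈ A.domain, A ⟨φ, h⟩ = ψ := by
  rw [LinearPMap.mem_graph_iff]
  constructor
  · rintro ⟨x, rfl, rfl⟩
    exact ⟨x.2, rfl⟩
  · rintro ⟨h, h'⟩
    exact ⟨⟨φ, h⟩, rfl, h'⟩

theorem mem_add_graph {A B : F →ₗ.[ℂ] F} {φ ψ : F} :
    (φ, ψ) ∈ (A + B).graph ↔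
      ∃ a b, (φ, a) ∈ A.graph ∧ (φ, b) ∈ B.graph ∧ ψ = a + b := by
  simp only [mk_mem_graph_iff]
  constructor
  · rintro ⟨h, rfl⟩
    exact ⟨_, _, ⟨h.1, rfl⟩, ⟨h.2, rfl⟩, LinearPMap.add_apply A B ⟨φ, h⟩⟩
  · rintro ⟨_, _, ⟨ha, rfl⟩, ⟨hb, rfl⟩, rfl⟩
    exact ⟨⟨ha, hb⟩, LinearPMap.add_apply A B ⟨φ, ha, hb⟩⟩

theorem mem_sum_graph {ι : Type*} (s : Finset ι) (A : ι → F →ₗ.[ℂ] F) (φ ψ : F) :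
    (φ, ψ) ∈ (∑ j ∈ s, A j).graph ↔
      ∃ v : ι → F, (∀ j ∈ s, (φ, v j) ∈ (A j).graph) ∧ ψ = ∑ j ∈ s, v j := by
  classical
  induction s using Finset.induction_on generalizing ψ with
  | empty =>
    rw [Finset.sum_empty, mk_mem_graph_iff]
    constructor
    · rintro ⟨x, rfl⟩
      exact ⟨0, by simp, by simp⟩
    · rintro ⟨v, -, rfl⟩
      exact ⟨trivial, by simp⟩
  | insert j s hj ih =>
    rw [Finset.sum_insert hj, mem_add_graph]
    constructor
    · rintro ⟨a, b, ha, hb, rfl⟩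
      obtain ⟨v, hv, rfl⟩ := (ih b).1 hb
      refine ⟨Function.update v j a, fun k hk => ?_, ?_⟩
      · by_cases hkj : k = j
        · subst hkj
          rwa [Function.update_self]
        · rw [Function.update_of_ne hkj]
          exact hv k (Finset.mem_of_mem_insert_of_ne hk hkj)
      · rw [Finset.sum_insert hj, Function.update_self, Finset.sum_update_of_notMem hj]
    · rintro ⟨v, hv, rfl⟩
      exact ⟨v j, ∑ j ∈ s, v j, hv j (Finset.mem_insert_self j s),
        (ih _).2 ⟨v, fun k hk => hv k (Finset.mem_insert_of_mem hk), rfl⟩, Finset.sum_insert hj⟩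

theorem mem_smul_graph {A : F →ₗ.[ℂ] F} {c : ℂ} {φ ψ : F} :
    (φ, ψ) ∈ (c • A).graph ↔ ∃ v, (φ, v) ∈ A.graph ∧ ψ = c • v := by
  rw [LinearPMap.smul_graph]
  constructor
  · rintro ⟨⟨a, b⟩, h, h'⟩
    simp only [LinearMap.prodMap_apply, LinearMap.id_coe, id_eq, LinearMap.smul_apply,
      Prod.mk.injEq] at h'
    exact ⟨b, h'.1 ▸ h, h'.2.symm⟩
  · rintro ⟨v, h, rfl⟩
    exact ⟨(φ, v), h, rfl⟩

/-- Two curves that solve the Schrödinger equations `f' = i B f`, `g' = i B g` with `B` symmetric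
have a constant inner product. -/
theorem inner_eq_of_hasDerivAt {f f' g g' : ℝ → F} (hf : ∀ t, HasDerivAt f (I • f' t) t)
    (hg : ∀ t, HasDerivAt g (I • g' t) t) (h : ∀ t, ⟪f' t, g t⟫ = ⟪f t, g' t⟫) (t : ℝ) :
    ⟪f t, g t⟫ = ⟪f 0, g 0⟫ := by
  have hd : ∀ s, HasDerivAt (fun s => ⟪f s, g s⟫) (0 : ℂ) s := fun s => by
    have h0 : ⟪f s, I • g' s⟫ + ⟪I • f' s, g s⟫ = 0 := by
      rw [inner_smul_left, inner_smul_right, h s]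
      simp
    exact h0 ▸ HasDerivAt.inner ℂ (hf s) (hg s)
  exact is_const_of_deriv_eq_zero (fun s => (hd s).differentiableAt) (fun s => (hd s).deriv) t 0

/-- The equality case of Cauchy–Schwarz; it turns conservation of inner products into uniqueness of
solutions. -/
theorem eq_of_inner_eq_of_norm_eq {a b : F} (h : ⟪a, b⟫ = (‖a‖ : ℂ) ^ 2) (h' : ‖b‖ = ‖a‖) :
    a = b := by
  have h1 : ‖a - b‖ ^ 2 = 0 := by
    rw [norm_sub_sq (𝕜 := ℂ), h, h']
    have : RCLike.re ((‖a‖ : ℂ) ^ 2) = ‖a‖ ^ 2 := by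
      rw [← ofReal_pow]; exact ofReal_re _
    rw [this]; ring
  exact sub_eq_zero.1 (norm_eq_zero.1 (pow_eq_zero_iff two_ne_zero |>.1 h1))

end SymmetricGraph

/-! ### Exponential series of entire vectors and essential self-adjointness. -/

section EntireVectors

variable {F : Type*} [NormedAddCommGroup F] [InnerProductSpace ℂ F] {D : Submodule ℂ F}

/-- The symmetric endomorphism `y` of the dense subspace `D` has an absolutely convergent
exponential series on `D`. -/
structure IsEntire (D : Submodule ℂ F) (y : Module.End ℂ D) : Prop where
  dense : Dense (D : Set F)
  symm : ∀ φ ψ : D, ⟪(y φ : F), (ψ : F)⟫ = ⟪(φ : F), (y ψ : F)⟫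
  summable : ∀ (φ : D) (t : ℝ), Summable fun m : ℕ => t ^ m / (m.factorial : ℝ) * ‖(y ^ m) φ‖

/-- The closure of the graph of an endomorphism of a subspace. -/
def endGraph (y : Module.End ℂ D) : Submodule ℂ (F × F) :=
  (LinearMap.range (D.subtype.prod (D.subtype ∘ₗ y))).topologicalClosure

theorem mem_endGraph (y : Module.End ℂ D) (φ : D) : ((φ : F), (y φ : F)) ∈ endGraph y :=
  Submodule.le_topologicalClosure _ ⟨φ, rfl⟩

theorem mem_endGraph_iff (y : Module.End ℂ D) (φ ψ : F) : (φ, ψ) ∈ endGraph y ↔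
    ∃ d : ℕ → D, Tendsto (fun n => (d n : F)) atTop (𝓝 φ) ∧
      Tendsto (fun n => (y (d n) : F)) atTop (𝓝 ψ) := by
  constructor
  · intro h
    obtain ⟨s, hs, hs'⟩ := mem_closure_iff_seq_limit.1 h
    choose d hd using hs
    refine ⟨d, ?_, ?_⟩
    · have := (continuous_fst.tendsto _).comp hs'
      refine this.congr fun n => ?_
      rw [Function.comp_apply, ← hd]; rfl
    · have := (continuous_snd.tendsto _).comp hs'
      refine this.congr fun n => ?_
      rw [Function.comp_apply, ← hd]; rfl
  · rintro ⟨d, h1, h2⟩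
    exact mem_closure_iff_seq_limit.2 ⟨fun n => (d n, y (d n)), fun n => ⟨d n, rfl⟩,
      h1.prodMk_nhds h2⟩

/-- The device for extending facts from `D` to the closure: `T` is often the preimage of a closed
relation under a continuous map. -/
theorem endGraph_le {y : Module.End ℂ D} {T : Submodule ℂ (F × F)} (hT : IsClosed (T : Set (F × F)))
    (h : ∀ φ : D, ((φ : F), (y φ : F)) ∈ T) : endGraph y ≤ T := by
  refine Submodule.topologicalClosure_minimal _ ?_ hT
  rintro _ ⟨φ, rfl⟩
  exact h φ

theorem isSymmGraph_endGraph {y : Module.End ℂ D}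
    (hy : ∀ φ ψ : D, ⟪(y φ : F), (ψ : F)⟫ = ⟪(φ : F), (y ψ : F)⟫) :
    IsSymmGraph (endGraph y) := by
  rintro ⟨a, a'⟩ ha ⟨b, b'⟩ hb
  obtain ⟨d, h1, h2⟩ := (mem_endGraph_iff y a a').1 ha
  obtain ⟨e, h3, h4⟩ := (mem_endGraph_iff y b b').1 hb
  exact tendsto_nhds_unique (h2.inner h3) ((h1.inner h4).congr fun n => (hy _ _).symm)

/-- The terms of the series of `exp (i t y)`. -/
noncomputable def expTerm (y : Module.End ℂ D) (t : ℝ) (m : ℕ) : Module.End ℂ D :=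
  ((I * t) ^ m / (m.factorial : ℂ)) • y ^ m

/-- The vector `exp (i t y) φ`. -/
noncomputable def expVec (y : Module.End ℂ D) (t : ℝ) (φ : D) : F :=
  ∑' m, (expTerm y t m φ : F)

theorem norm_expTerm (y : Module.End ℂ D) (t : ℝ) (m : ℕ) (φ : D) :
    ‖(expTerm y t m φ : F)‖ = |t| ^ m / (m.factorial : ℝ) * ‖(y ^ m) φ‖ := by
  simp [expTerm, norm_smul]

variable {y : Module.End ℂ D}

theorem IsEntire.summable_expTerm [CompleteSpace F] (hy : IsEntire D y) (t : ℝ) (φ : D) :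
    Summable fun m => (expTerm y t m φ : F) :=
  Summable.of_norm (by simpa only [norm_expTerm] using hy.summable φ |t|)

theorem IsEntire.tendsto_expVec [CompleteSpace F] (hy : IsEntire D y) (t : ℝ) (φ : D) :
    Tendsto (fun N => ((∑ m ∈ Finset.range N, expTerm y t m φ : D) : F)) atTop
      (𝓝 (expVec y t φ)) := by
  simpa [expVec] using (hy.summable_expTerm t φ).hasSum.tendsto_sum_nat

theorem expVec_zero (y : Module.End ℂ D) (φ : D) : expVec y 0 φ = φ := by
  rw [expVec, tsum_eq_single 0 fun m hm => by simp [expTerm, hm]]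
  simp [expTerm]

theorem expVec_neg (y : Module.End ℂ D) (t : ℝ) (φ : D) : expVec (-y) t φ = expVec y (-t) φ := by
  refine tsum_congr fun m => ?_
  have : expTerm (-y) t m = expTerm y (-t) m := by
    rw [expTerm, expTerm, ← neg_one_smul ℂ y, smul_pow, smul_smul, ofReal_neg, mul_neg,
      neg_pow (I * (t : ℂ)) m]
    congr 1
    ring
  rw [this]

/-- Commutation with `x` is a derivation, and its value `κ` on `y` is central. -/
theorem commutator_pow {R : Type*} [Ring R] [Algebra ℂ R] {x y : R} {κ : ℂ}
    (h : x * y - y * x = κ • 1) (m : ℕ) :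
    x * y ^ (m + 1) = y ^ (m + 1) * x + ((m + 1 : ℂ) * κ) • y ^ m := by
  have h' : x * y = y * x + κ • 1 := by rw [← h]; abel
  induction m with
  | zero => simp [h']
  | succ m ih =>
    rw [pow_succ y (m + 1), ← mul_assoc, ih, add_mul, mul_assoc _ x y, h', mul_add, smul_mul_assoc,
      ← pow_succ, mul_smul_comm, mul_one, add_assoc, ← add_smul, mul_assoc]
    congr 2
    push_cast
    ring

/-- The factor `m + 1` from the commutator cancels against `(m + 1)!`, leaving the previous term of
the series. -/
theorem mul_expTerm_succ {x y : Module.End ℂ D} {κ : ℂ} (h : x * y - y * x = κ • 1) (t : ℝ)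
    (m : ℕ) : x * expTerm y t (m + 1) = expTerm y t (m + 1) * x + (κ * (I * t)) • expTerm y t m := by
  rw [expTerm, expTerm, mul_smul_comm, commutator_pow h, smul_add, smul_mul_assoc, smul_smul,
    smul_smul]
  congr 2
  have : (m.factorial : ℂ) ≠ 0 := by exact_mod_cast m.factorial_ne_zero
  have : (m + 1 : ℂ) ≠ 0 := by exact_mod_cast m.succ_ne_zero
  rw [Nat.factorial_succ]
  push_cast
  field_simp
  ring

/-- The zeroth term commutes with `x`, so the correction has one term fewer than the sum. -/
theorem mul_sum_expTerm {x y : Module.End ℂ D} {κ : ℂ} (h : x * y - y * x = κ • 1) (t : ℝ)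
    (N : ℕ) : x * ∑ m ∈ Finset.range (N + 1), expTerm y t m =
      (∑ m ∈ Finset.range (N + 1), expTerm y t m) * x +
        (κ * (I * t)) • ∑ m ∈ Finset.range N, expTerm y t m := by
  simp only [Finset.sum_range_succ' _ N, mul_add, add_mul, Finset.mul_sum, Finset.sum_mul,
    mul_expTerm_succ h, Finset.sum_add_distrib, Finset.smul_sum]
  simp only [expTerm, pow_zero, Nat.factorial_zero, Nat.cast_one, div_one, one_smul, one_mul,
    mul_one]
  abel

/-- If `[x, y] = κ` then `x exp (i t y) = exp (i t y) (x + i t κ)`. -/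
theorem IsEntire.expVec_mem_endGraph [CompleteSpace F] (hy : IsEntire D y) {x : Module.End ℂ D}
    {κ : ℂ} (h : x * y - y * x = κ • 1) (t : ℝ) (φ : D) :
    (expVec y t φ, expVec y t (x φ) + (κ * (I * t)) • expVec y t φ) ∈ endGraph x := by
  rw [mem_endGraph_iff]
  -- The partial sums lie in `D`, and their images under `x` converge as well, which is what
  -- membership in the closed graph requires.
  refine ⟨fun N => ∑ m ∈ Finset.range (N + 1), expTerm y t m φ,
    (hy.tendsto_expVec t φ).comp (tendsto_add_atTop_nat 1), ?_⟩
  refine (((hy.tendsto_expVec t (x φ)).comp (tendsto_add_atTop_nat 1)).add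
    ((hy.tendsto_expVec t φ).const_smul (κ * (I * t)))).congr fun N => ?_
  have := congrArg (fun z : Module.End ℂ D => ((z φ : D) : F)) (mul_sum_expTerm h t N)
  simpa [LinearMap.sum_apply] using this.symm

theorem IsEntire.expVec_mem_endGraph_self [CompleteSpace F] (hy : IsEntire D y) (t : ℝ) (φ : D) :
    (expVec y t φ, expVec y t (y φ)) ∈ endGraph y := by
  simpa using hy.expVec_mem_endGraph (x := y) (κ := 0) (by simp) t φ

/-- Termwise differentiation: the zeroth term is constant, and term `m + 1` differentiates to `i`
times term `m` of the series at `y φ`. -/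
theorem IsEntire.hasDerivAt_expVec [CompleteSpace F] (hy : IsEntire D y) (φ : D) (t : ℝ) :
    HasDerivAt (fun s => expVec y s φ) (I • expVec y t (y φ)) t := by
  set g' : ℕ → ℝ → F := fun m s => match m with
    | 0 => 0
    | m + 1 => I • (expTerm y s m (y φ) : F) with hg'
  have hd : ∀ m s, HasDerivAt (fun s => (expTerm y s m φ : F)) (g' m s) s := by
    intro m s
    cases m with
    | zero => simpa [expTerm, hg'] using hasDerivAt_const s (φ : F)
    | succ m =>
      have h1 : HasDerivAt (fun s : ℝ => I * (s : ℂ)) I s := by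
        simpa using (hasDerivAt_id s).ofReal_comp.const_mul I
      have h2 := ((h1.fun_pow (m + 1)).div_const ((m + 1).factorial : ℂ)).smul_const
        (((y ^ (m + 1)) φ : D) : F)
      simp only [hg', expTerm, LinearMap.smul_apply, Submodule.coe_smul]
      convert h2 using 1
      rw [smul_smul, pow_succ y m]
      congr 1
      have : (m.factorial : ℂ) ≠ 0 := by exact_mod_cast m.factorial_ne_zero
      have : (m + 1 : ℂ) ≠ 0 := by exact_mod_cast m.succ_ne_zero
      rw [Nat.factorial_succ]
      push_cast
      field_simp
  -- On the unit ball about `t` the derivatives are dominated by the series at `|t| + 1`.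
  have hu : Summable fun m : ℕ => match m with
      | 0 => (0 : ℝ)
      | m + 1 => (|t| + 1) ^ m / (m.factorial : ℝ) * ‖(y ^ m) (y φ)‖ := by
    rw [← summable_nat_add_iff 1]
    exact hy.summable (y φ) (|t| + 1)
  have key := hasDerivAt_tsum_of_isPreconnected (t := Metric.ball t 1) (g' := g') hu
    Metric.isOpen_ball
    (convex_ball t 1).isPreconnected (fun m s _ => hd m s) (fun m s hs => by
      cases m with
      | zero => simp [hg']
      | succ m =>
        simp only [hg', norm_smul, norm_I, one_mul, norm_expTerm]
        have : |s| ≤ |t| + 1 := by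
          rw [Metric.mem_ball, Real.dist_eq] at hs
          linarith [abs_sub_abs_le_abs_sub s t]
        gcongr) (Metric.mem_ball_self one_pos) (hy.summable_expTerm t φ)
    (Metric.mem_ball_self one_pos)
  refine key.congr_deriv ?_
  have h0 : Summable fun m => g' m t := by
    rw [← summable_nat_add_iff 1]
    exact (hy.summable_expTerm t (y φ)).const_smul I
  rw [h0.tsum_eq_zero_add]
  simp only [hg', zero_add]
  rw [expVec, (hy.summable_expTerm t (y φ)).tsum_const_smul]

/-- Both curves solve the same equation with a symmetric generator, so no double series has to be
rearranged. -/
theorem IsEntire.inner_expVec [CompleteSpace F] (hy : IsEntire D y) (t : ℝ) (φ ψ : D) :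
    ⟪expVec y t φ, expVec y t ψ⟫ = ⟪(φ : F), (ψ : F)⟫ := by
  have := inner_eq_of_hasDerivAt (fun t => hy.hasDerivAt_expVec φ t)
    (fun t => hy.hasDerivAt_expVec ψ t) (fun t => isSymmGraph_endGraph hy.symm
      _ (hy.expVec_mem_endGraph_self t φ) _ (hy.expVec_mem_endGraph_self t ψ)) t
  simpa only [expVec_zero] using this

theorem IsEntire.norm_expVec [CompleteSpace F] (hy : IsEntire D y) (t : ℝ) (φ : D) :
    ‖expVec y t φ‖ = ‖φ‖ := by
  rw [← sq_eq_sq₀ (norm_nonneg _) (norm_nonneg _), ← inner_self_eq_norm_sq (𝕜 := ℂ),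
    hy.inner_expVec, inner_self_eq_norm_sq]
  rfl

/-- `y + i` has dense range. -/
theorem IsEntire.dense_range [CompleteSpace F] (hy : IsEntire D y) :
    Dense (Set.range fun d : D => (y d : F) + I • (d : F)) := by
  have h1 : (LinearMap.range (D.subtype ∘ₗ y + I • D.subtype)).topologicalClosure = ⊤ := by
    rw [Submodule.topologicalClosure_eq_top_iff, Submodule.eq_bot_iff]
    intro η hη
    have h2 : ∀ d : D, ⟪η, (y d : F)⟫ = -I * ⟪η, (d : F)⟫ := fun d => by
      have := (Submodule.mem_orthogonal' _ _).1 hη _ ⟨d, rfl⟩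
      simp only [LinearMap.add_apply, LinearMap.comp_apply, Submodule.subtype_apply,
        LinearMap.smul_apply, inner_add_right, inner_smul_right] at this
      linear_combination this
    have h3 : ∀ (m : ℕ) (d : D), ⟪η, ((y ^ m) d : F)⟫ = (-I) ^ m * ⟪η, (d : F)⟫ := by
      intro m
      induction m with
      | zero => simp
      | succ m ih => intro d; rw [pow_succ', Module.End.mul_apply, h2, ih]; ring
    -- A vector `η` orthogonal to the range acts as an eigenvector: `(i t)^m (-i)^m = t^m` makes the
    -- paired series a real exponential.
    have h4 : ∀ (t : ℝ) (d : D), ⟪η, expVec y t d⟫ = exp t * ⟪η, (d : F)⟫ := by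
      intro t d
      have e1 : HasSum (fun m => ⟪η, (expTerm y t m d : F)⟫) ⟪η, expVec y t d⟫ :=
        (hy.summable_expTerm t d).hasSum.mapL (innerSL ℂ η)
      have e2 : HasSum (fun m : ℕ => (t : ℂ) ^ m / (m.factorial : ℂ) * ⟪η, (d : F)⟫)
          (exp t * ⟪η, (d : F)⟫) := by
        rw [Complex.exp_eq_exp_ℂ]
        exact (NormedSpace.expSeries_div_hasSum_exp (t : ℂ)).mul_right _
      refine e1.unique (e2.congr_fun fun m => ?_)
      rw [expTerm, LinearMap.smul_apply, Submodule.coe_smul, inner_smul_right, h3, mul_pow,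
        ← mul_assoc, div_mul_eq_mul_div, mul_right_comm, ← mul_pow]
      simp
    -- The orbit has constant norm, so the pairing cannot grow like `exp t` unless it vanishes.
    have h5 : ∀ d : D, ⟪(d : F), η⟫ = 0 := by
      intro d
      by_contra hne
      have hpos : 0 < ‖⟪η, (d : F)⟫‖ := by
        rwa [norm_pos_iff, ← inner_conj_symm, Ne, map_eq_zero]
      have hb : ∀ t : ℝ, Real.exp t * ‖⟪η, (d : F)⟫‖ ≤ ‖η‖ * ‖d‖ := fun t => by
        have := norm_inner_le_norm (𝕜 := ℂ) η (expVec y t d)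
        rwa [h4, hy.norm_expVec, norm_mul, norm_exp_ofReal] at this
      obtain ⟨t, ht⟩ := ((Real.tendsto_exp_atTop.atTop_mul_const hpos).eventually_gt_atTop
        (‖η‖ * ‖d‖)).exists
      exact absurd (hb t) ht.not_ge
    exact hy.dense.eq_zero_of_inner_right ℂ fun d hd => h5 ⟨d, hd⟩
  have h6 := Submodule.dense_iff_topologicalClosure_eq_top.2 h1
  exact h6

/-- A symmetric endomorphism of `D` with entire vectors is essentially self-adjoint. -/
theorem IsEntire.le_endGraph [CompleteSpace F] (hy : IsEntire D y) {T : Submodule ℂ (F × F)}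
    (hT : IsSymmGraph T) (h : ∀ φ : D, ((φ : F), (y φ : F)) ∈ T) : T ≤ endGraph y := by
  rintro ⟨φ, ψ⟩ hφ
  refine Metric.mem_closure_iff.2 fun ε hε => ?_
  obtain ⟨_, ⟨d, rfl⟩, hd⟩ := hy.dense_range.exists_dist_lt (ψ + I • φ) hε
  refine ⟨(d, y d), ⟨d, rfl⟩, ?_⟩
  -- The difference of the two pairs lies in `T`, so approximating `ψ + i φ` alone approximates `φ`
  -- and `ψ` separately.
  have h1 := hT.norm_sq (T.sub_mem hφ (h d))
  rw [dist_eq_norm] at hd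
  have h2 : ψ - (y d : F) + I • (φ - (d : F)) = ψ + I • φ - ((y d : F) + I • (d : F)) := by
    rw [smul_sub]; abel
  rw [h2] at h1
  rw [Prod.dist_eq, dist_eq_norm, dist_eq_norm, max_lt_iff]
  constructor
  · refine lt_of_le_of_lt (abs_le_of_sq_le_sq' ?_ (norm_nonneg _)).2 hd
    rw [h1]; linarith [sq_nonneg ‖ψ - (y d : F)‖]
  · refine lt_of_le_of_lt (abs_le_of_sq_le_sq' ?_ (norm_nonneg _)).2 hd
    rw [h1]; linarith [sq_nonneg ‖φ - (d : F)‖]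

end EntireVectors

/-! ### The unitary group generated by the closure of `y`. -/

section UnitaryGroup

variable {F : Type*} [NormedAddCommGroup F] [InnerProductSpace ℂ F] [CompleteSpace F]
  {D : Submodule ℂ F} {y : Module.End ℂ D}

/-- The linear map `φ ↦ exp (i t y) φ` on `D`. -/
noncomputable def expLin (hy : IsEntire D y) (t : ℝ) : D →ₗ[ℂ] F where
  toFun := expVec y t
  map_add' φ ψ := by
    simp only [expVec, map_add, Submodule.coe_add]
    exact (hy.summable_expTerm t φ).tsum_add (hy.summable_expTerm t ψ)
  map_smul' c φ := by
    simp only [expVec, map_smul, Submodule.coe_smul, RingHom.id_apply]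
    exact (hy.summable_expTerm t φ).tsum_const_smul c

/-- The isometry `exp (i t y)`. -/
noncomputable def expCLM (hy : IsEntire D y) (t : ℝ) : F →L[ℂ] F :=
  (expLin hy t).extendOfNorm D.subtype

theorem expCLM_coe (hy : IsEntire D y) (t : ℝ) (φ : D) : expCLM hy t φ = expVec y t φ :=
  LinearMap.extendOfNorm_eq (f := expLin hy t) (e := D.subtype) hy.dense.denseRange_val
    ⟨1, fun φ => by rw [one_mul]; exact (hy.norm_expVec t φ).le⟩ φ

theorem inner_expCLM (hy : IsEntire D y) (t : ℝ) (φ ψ : F) :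
    ⟪expCLM hy t φ, expCLM hy t ψ⟫ = ⟪φ, ψ⟫ := by
  refine hy.dense.induction (P := fun φ => ⟪expCLM hy t φ, expCLM hy t ψ⟫ = ⟪φ, ψ⟫)
    (fun φ hφ => ?_) (isClosed_eq (by fun_prop) (by fun_prop)) φ
  refine hy.dense.induction (P := fun ψ => ⟪expCLM hy t φ, expCLM hy t ψ⟫ = ⟪φ, ψ⟫)
    (fun ψ hψ => ?_) (isClosed_eq (by fun_prop) (by fun_prop)) ψ
  rw [expCLM_coe hy t ⟨φ, hφ⟩, expCLM_coe hy t ⟨ψ, hψ⟩]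
  exact hy.inner_expVec t _ _

theorem norm_expCLM (hy : IsEntire D y) (t : ℝ) (φ : F) : ‖expCLM hy t φ‖ = ‖φ‖ := by
  rw [← sq_eq_sq₀ (norm_nonneg _) (norm_nonneg _), ← inner_self_eq_norm_sq (𝕜 := ℂ),
    inner_expCLM, inner_self_eq_norm_sq]

theorem expCLM_mem_endGraph (hy : IsEntire D y) (t : ℝ) {φ ψ : F} (h : (φ, ψ) ∈ endGraph y) :
    (expCLM hy t φ, expCLM hy t ψ) ∈ endGraph y := by
  have : endGraph y ≤
      (endGraph y).comap ((expCLM hy t).prodMap (expCLM hy t) : F × F →L[ℂ] F × F).toLinearMap := by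
    refine endGraph_le ?_ fun d => ?_
    · exact (Submodule.isClosed_topologicalClosure _).preimage
        ((expCLM hy t).prodMap (expCLM hy t)).continuous
    · change (expCLM hy t d, expCLM hy t (y d)) ∈ endGraph y
      rw [expCLM_coe, expCLM_coe]
      exact hy.expVec_mem_endGraph_self t d
  exact this h

theorem hasDerivAt_expCLM_coe (hy : IsEntire D y) (φ : D) (t : ℝ) :
    HasDerivAt (fun s => expCLM hy s φ) (I • expCLM hy t (y φ)) t := by
  simpa only [expCLM_coe] using hy.hasDerivAt_expVec φ t

/-- For approximants in `D` the derivatives converge uniformly in time, because each `expCLM hy s`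
is isometric. -/
theorem hasDerivAt_expCLM (hy : IsEntire D y) {φ ψ : F} (h : (φ, ψ) ∈ endGraph y) (t : ℝ) :
    HasDerivAt (fun s => expCLM hy s φ) (I • expCLM hy t ψ) t := by
  obtain ⟨d, h1, h2⟩ := (mem_endGraph_iff y φ ψ).1 h
  refine hasDerivAt_of_tendstoUniformly (l := atTop) (f := fun n s => expCLM hy s (d n))
    (f' := fun n s => I • expCLM hy s (y (d n))) (g' := fun s => I • expCLM hy s ψ) ?_
    (Eventually.of_forall fun n s => hasDerivAt_expCLM_coe hy (d n) s)
    (fun s => ((expCLM hy s).continuous.tendsto φ).comp h1) t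
  rw [Metric.tendstoUniformly_iff]
  intro ε hε
  filter_upwards [Metric.tendsto_nhds.1 h2 ε hε] with n hn s
  rwa [dist_eq_norm, ← smul_sub, norm_smul, norm_I, one_mul, ← map_sub, norm_expCLM, ← dist_eq_norm,
    dist_comm]

theorem expCLM_zero (hy : IsEntire D y) : expCLM hy 0 = 1 := by
  refine ContinuousLinearMap.ext fun φ => ?_
  refine hy.dense.induction (P := fun φ => expCLM hy 0 φ = φ) (fun φ hφ => ?_)
    (isClosed_eq (by fun_prop) (by fun_prop)) φ
  rw [expCLM_coe hy 0 ⟨φ, hφ⟩, expVec_zero]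

/-- For `φ` in `D`, both sides as curves in `t` solve the same Schrödinger equation with the same
initial value. -/
theorem expCLM_add (hy : IsEntire D y) (s t : ℝ) :
    expCLM hy (s + t) = expCLM hy s * expCLM hy t := by
  refine ContinuousLinearMap.ext fun φ => ?_
  refine hy.dense.induction (P := fun φ => expCLM hy (s + t) φ = (expCLM hy s * expCLM hy t) φ)
    (fun φ hφ => ?_) (isClosed_eq (by fun_prop) (by fun_prop)) φ
  lift φ to D using hφ
  have hG := mem_endGraph y φ
  have h1 : ∀ r, HasDerivAt (fun r => expCLM hy (s + r) φ) (I • expCLM hy (s + r) (y φ)) r :=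
    fun r => by simpa using (hasDerivAt_expCLM_coe hy φ (s + r)).comp_const_add s r
  have h2 : ∀ r, HasDerivAt (fun r => expCLM hy s (expCLM hy r φ))
      (I • expCLM hy s (expCLM hy r (y φ))) r := fun r => by
    have := ((expCLM hy s).restrictScalars ℝ).hasFDerivAt.comp_hasDerivAt r
      (hasDerivAt_expCLM_coe hy φ r)
    rw [ContinuousLinearMap.coe_restrictScalars', map_smul] at this
    exact this
  have h3 := inner_eq_of_hasDerivAt h1 h2 (fun r => isSymmGraph_endGraph hy.symm
    _ (expCLM_mem_endGraph hy (s + r) hG) _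
      (expCLM_mem_endGraph hy s (expCLM_mem_endGraph hy r hG))) t
  refine eq_of_inner_eq_of_norm_eq (h3.trans ?_) ?_
  · simp only [expCLM_zero, add_zero, one_apply_eq_self]
    rw [inner_self_eq_norm_sq_to_K, norm_expCLM, norm_expCLM]
    rfl
  · simp only [mul_apply_eq_comp, norm_expCLM]

theorem expCLM_mul_neg (hy : IsEntire D y) (t : ℝ) : expCLM hy t * expCLM hy (-t) = 1 := by
  rw [← expCLM_add, add_neg_cancel, expCLM_zero]

theorem star_expCLM (hy : IsEntire D y) (t : ℝ) : star (expCLM hy t) = expCLM hy (-t) := by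
  have h : star (expCLM hy t) * expCLM hy t = 1 :=
    (ContinuousLinearMap.norm_map_iff_adjoint_comp_self _).1 (norm_expCLM hy t)
  exact left_inv_eq_right_inv h (expCLM_mul_neg hy t)

theorem isUnitaryGroup_expCLM (hy : IsEntire D y) {A : F →ₗ.[ℂ] F} (hA : A.graph = endGraph y) :
    IsUnitaryGroup A (expCLM hy) where
  unitary t := by
    rw [Unitary.mem_iff, star_expCLM]
    exact ⟨by simpa using expCLM_mul_neg hy (-t), expCLM_mul_neg hy t⟩
  zero := expCLM_zero hy
  add := expCLM_add hy
  continuous φ := by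
    refine continuous_iff_continuousAt.2 fun t => Metric.continuousAt_iff'.2 fun ε hε => ?_
    obtain ⟨d, hd, hd'⟩ := hy.dense.exists_dist_lt φ (show 0 < ε / 3 by positivity)
    lift d to D using hd
    filter_upwards [Metric.continuousAt_iff'.1 (hasDerivAt_expCLM_coe hy d t).continuousAt (ε / 3)
      (by positivity)] with s hs
    have h1 : ∀ r, dist (expCLM hy r φ) (expCLM hy r d) < ε / 3 := fun r => by
      rwa [dist_eq_norm, ← map_sub, norm_expCLM, ← dist_eq_norm]
    have h2 := dist_triangle4_right (expCLM hy s φ) (expCLM hy t φ) (expCLM hy s d) (expCLM hy t d)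
    linarith [h1 s, h1 t]
  generator φ ψ := by
    rw [hA]
    refine ⟨fun h => by simpa [expCLM_zero] using hasDerivAt_expCLM hy h 0, fun h => ?_⟩
    -- The pairs satisfying the derivative condition form a relation that contains `y` and is
    -- symmetric, as differentiating the conserved inner product shows; maximality puts it inside
    -- `endGraph y`.
    let T : Submodule ℂ (F × F) :=
      { carrier := {p | HasDerivAt (fun t => expCLM hy t p.1) (I • p.2) 0}
        zero_mem' := by simpa using hasDerivAt_const (0 : ℝ) (0 : F)
        add_mem' := fun {p q} hp hq => by
          change HasDerivAt (fun t => expCLM hy t (p.1 + q.1)) (I • (p.2 + q.2)) 0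
          simpa only [map_add, smul_add] using HasDerivAt.fun_add hp hq
        smul_mem' := fun c p hp => by
          change HasDerivAt (fun t => expCLM hy t (c • p.1)) (I • c • p.2) 0
          simpa only [map_smul, smul_comm I c] using HasDerivAt.fun_const_smul c hp }
    refine hy.le_endGraph (T := T) (fun p hp q hq => ?_) (fun d => ?_) h
    · have h1 : HasDerivAt (fun t => ⟪expCLM hy t p.1, expCLM hy t q.1⟫) _ 0 :=
        HasDerivAt.inner ℂ hp hq
      simp only [inner_expCLM, expCLM_zero, one_apply_eq_self] at h1
      have h2 := h1.unique (hasDerivAt_const _ _)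
      rw [inner_smul_left, inner_smul_right, conj_I] at h2
      refine mul_left_cancel₀ I_ne_zero ?_
      linear_combination -h2
    · change HasDerivAt (fun t => expCLM hy t d) (I • (y d : F)) 0
      simpa [expCLM_zero] using hasDerivAt_expCLM_coe hy d 0

/-- `expI` chooses some group, so uniqueness is needed; conserved inner products and equal norms
give it on `D`. -/
theorem expI_eq_expCLM (hy : IsEntire D y) {A : F →ₗ.[ℂ] F} (hA : A.graph = endGraph y) :
    expI A = expCLM hy 1 := by
  have hex : ∃ V : ℝ → F →L[ℂ] F, IsUnitaryGroup A V := ⟨_, isUnitaryGroup_expCLM hy hA⟩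
  rw [expI, dif_pos hex]
  have hV := hex.choose_spec
  set V := hex.choose
  refine ContinuousLinearMap.ext fun φ => ?_
  refine hy.dense.induction (P := fun φ => V 1 φ = expCLM hy 1 φ) (fun φ hφ => ?_)
    (isClosed_eq (by fun_prop) (by fun_prop)) φ
  lift φ to D using hφ
  have hG : ((φ : F), (y φ : F)) ∈ A.graph := hA ▸ mem_endGraph y φ
  have h1 := inner_eq_of_hasDerivAt (fun t => (hV.hasDerivAt hG t).2)
    (hasDerivAt_expCLM_coe hy φ) (fun t => isSymmGraph_endGraph hy.symm
      _ (hA ▸ (hV.hasDerivAt hG t).1) _ (expCLM_mem_endGraph hy t (mem_endGraph y φ))) 1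
  have h2 : ‖V 1 φ‖ = ‖(φ : F)‖ := ContinuousLinearMap.norm_map_of_mem_unitary (hV.unitary 1) _
  refine eq_of_inner_eq_of_norm_eq (h1.trans ?_) ?_
  · rw [expCLM_zero, hV.zero, one_apply_eq_self, inner_self_eq_norm_sq_to_K, h2]
    rfl
  · rw [norm_expCLM, h2]

/-- The closure of a symmetric operator that extends `y` is the closure of `y`. -/
theorem graph_closure_eq_endGraph (hy : IsEntire D y) {A : F →ₗ.[ℂ] F} (hA : IsSymmGraph A.graph)
    (h : ∀ φ : D, ((φ : F), (y φ : F)) ∈ A.graph) : A.closure.graph = endGraph y := by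
  have h1 : A.graph.topologicalClosure = endGraph y :=
    le_antisymm (Submodule.topologicalClosure_minimal _ (hy.le_endGraph hA h)
      (Submodule.isClosed_topologicalClosure _))
      (endGraph_le (Submodule.isClosed_topologicalClosure _)
        fun φ => Submodule.le_topologicalClosure _ (h φ))
  rw [← LinearPMap.IsClosable.graph_closure_eq_closure_graph, h1]
  -- Closability: in a pair `(0, b)` of the closed symmetric relation, `b` is orthogonal to the
  -- dense `D`.
  refine ⟨(endGraph y).toLinearPMap, h1.trans (Submodule.toLinearPMap_graph_eq _ ?_).symm⟩
  rintro ⟨a, b⟩ hab ha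
  simp only at ha
  subst ha
  refine hy.dense.eq_zero_of_inner_left ℂ fun d hd => ?_
  have := isSymmGraph_endGraph hy.symm _ hab _ (mem_endGraph y ⟨d, hd⟩)
  simpa using this

/-- Maximality gives one inclusion, closedness of `A` the other; thus `D` is a core. -/
theorem graph_eq_endGraph (hy : IsEntire D y) {A : F →ₗ.[ℂ] F} (hA : IsSelfAdjoint A)
    (h : ∀ φ : D, ((φ : F), (y φ : F)) ∈ A.graph) : A.graph = endGraph y :=
  le_antisymm (hy.le_endGraph (isSymmGraph_of_isSelfAdjoint hA) h) (endGraph_le hA.isClosed h)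

end UnitaryGroup

/-! ### Graphs of products, differences and bounded operators. -/

section Graphs

variable {F : Type*} [NormedAddCommGroup F] [InnerProductSpace ℂ F]

theorem mem_ofCLM_graph {T : F →L[ℂ] F} {φ ψ : F} : (φ, ψ) ∈ (ofCLM T).graph ↔ ψ = T φ := by
  rw [mk_mem_graph_iff]
  exact ⟨fun ⟨_, h⟩ => h.symm, fun h => ⟨trivial, h.symm⟩⟩

theorem mem_mul_graph {A B : F →ₗ.[ℂ] F} {φ ψ : F} :
    (φ, ψ) ∈ (mul A B).graph ↔ ∃ a, (φ, a) ∈ B.graph ∧ (a, ψ) ∈ A.graph := by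
  simp only [mk_mem_graph_iff]
  constructor
  · rintro ⟨h, rfl⟩
    obtain ⟨h1, h2⟩ := (mem_mul_domain A B φ).1 h
    exact ⟨_, ⟨h1, rfl⟩, h2, (mul_apply A B φ h1 h2 h).symm⟩
  · rintro ⟨_, ⟨h1, rfl⟩, h2, rfl⟩
    exact ⟨(mem_mul_domain A B φ).2 ⟨h1, h2⟩, rfl⟩

theorem mem_sub_graph {A B : F →ₗ.[ℂ] F} {φ ψ : F} :
    (φ, ψ) ∈ (A - B).graph ↔
      ∃ a b, (φ, a) ∈ A.graph ∧ (φ, b) ∈ B.graph ∧ ψ = a - b := by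
  simp only [mk_mem_graph_iff]
  constructor
  · rintro ⟨h, rfl⟩
    exact ⟨_, _, ⟨h.1, rfl⟩, ⟨h.2, rfl⟩, LinearPMap.sub_apply A B ⟨φ, h⟩⟩
  · rintro ⟨_, _, ⟨ha, rfl⟩, ⟨hb, rfl⟩, rfl⟩
    exact ⟨⟨ha, hb⟩, LinearPMap.sub_apply A B ⟨φ, ha, hb⟩⟩

theorem eq_ofCLM {A : F →ₗ.[ℂ] F} {T : F →L[ℂ] F} (h : ∀ φ, (φ, T φ) ∈ A.graph) :
    A = ofCLM T := by
  refine (LinearPMap.eq_of_le_of_domain_eq (LinearPMap.le_of_le_graph ?_) ?_).symm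
  · rintro ⟨φ, ψ⟩ hφ
    rw [mem_ofCLM_graph.1 hφ]
    exact h φ
  · exact (eq_top_iff.2 fun φ _ => LinearPMap.mem_domain_iff.2 ⟨_, h φ⟩).symm

theorem isSelfAdjoint_ofCLM [CompleteSpace F] {T : F →L[ℂ] F}
    (hT : ∀ φ ψ, ⟪T φ, ψ⟫ = ⟪φ, T ψ⟫) : IsSelfAdjoint (ofCLM T) := by
  have h := ContinuousLinearMap.toPMap_adjoint_eq_adjoint_toPMap_of_dense T (p := ⊤) (by simp)
  rw [← (ContinuousLinearMap.eq_adjoint_iff T T).2 hT] at h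
  exact h

theorem isClosed_ofCLM (T : F →L[ℂ] F) : (ofCLM T).IsClosed := by
  have : ((ofCLM T).graph : Set (F × F)) = {p | p.2 = T p.1} := by
    ext ⟨φ, ψ⟩
    exact mem_ofCLM_graph
  rw [LinearPMap.IsClosed, this]
  exact isClosed_eq continuous_snd (T.continuous.comp continuous_fst)

/-- Approximating `φ` in the dense domain makes the values converge to `T φ` by continuity. -/
theorem closure_eq_ofCLM {A : F →ₗ.[ℂ] F} {T : F →L[ℂ] F} (hA : Dense (A.domain : Set F))
    (h : A ≤ ofCLM T) : A.closure = ofCLM T := by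
  have hc : A.IsClosable := (isClosed_ofCLM T).isClosable.leIsClosable h
  refine eq_ofCLM fun φ => ?_
  refine hA.induction (P := fun φ => (φ, T φ) ∈ A.closure.graph) (fun φ hφ => ?_)
    (hc.closure_isClosed.preimage (continuous_id.prodMk T.continuous)) φ
  have h1 := A.mem_graph ⟨φ, hφ⟩
  have h2 := mem_ofCLM_graph.1 (LinearPMap.le_graph_of_le h h1)
  rw [← h2]
  exact LinearPMap.le_graph_of_le A.le_closure h1

end Graphs

/-! ### Weyl unitaries and the translation of `Xⱼ`. -/

section WeylOperators

variable {F : Type*} [NormedAddCommGroup F] [InnerProductSpace ℂ F] [CompleteSpace F] {n : ℕ}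
  {Θ : Matrix (Fin n) (Fin n) ℝ} {X : Fin n → F →ₗ.[ℂ] F}
  {D : Submodule ℂ F} {x : Fin n → Module.End ℂ D}

theorem IsCCRDomain.isEntire (hX : ∀ j, IsSelfAdjoint (X j)) (hD : IsCCRDomain Θ X D x)
    (l : EuclideanSpace ℝ (Fin n)) : IsEntire D (∑ j, (l j : ℂ) • x j) where
  dense := hD.dense
  symm φ ψ := by
    simp only [LinearMap.sum_apply, LinearMap.smul_apply, Submodule.coe_sum, Submodule.coe_smul,
      sum_inner, inner_sum, inner_smul_left, inner_smul_right, conj_ofReal]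
    exact Finset.sum_congr rfl fun j _ => congrArg _
      (isSymmGraph_of_isSelfAdjoint (hX j) _ (hD.graph j φ) _ (hD.graph j ψ))
  summable := hD.summable l

theorem IsCCRDomain.isEntire_single (hX : ∀ j, IsSelfAdjoint (X j)) (hD : IsCCRDomain Θ X D x)
    (j : Fin n) : IsEntire D (x j) := by
  have := hD.isEntire hX (EuclideanSpace.single j 1)
  rwa [Finset.sum_eq_single j (fun k _ hk => by simp [hk]) (by simp), PiLp.single_apply, if_pos rfl,
    ofReal_one, one_smul] at this

/-- The sum on the common domain is symmetric and extends the endomorphism of `D`, so essential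
self-adjointness fixes its closure. -/
theorem IsCCRDomain.graph_linForm (hX : ∀ j, IsSelfAdjoint (X j)) (hD : IsCCRDomain Θ X D x)
    (l : EuclideanSpace ℝ (Fin n)) : (linForm X l).graph = endGraph (∑ j, (l j : ℂ) • x j) := by
  refine graph_closure_eq_endGraph (hD.isEntire hX l) ?_ fun φ => ?_
  · rintro ⟨a, a'⟩ ha ⟨b, b'⟩ hb
    obtain ⟨v, hv, rfl⟩ := (mem_sum_graph _ _ _ _).1 ha
    obtain ⟨w, hw, rfl⟩ := (mem_sum_graph _ _ _ _).1 hb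
    simp only [sum_inner, inner_sum]
    refine Finset.sum_congr rfl fun j hj => ?_
    obtain ⟨v', hv', hvv'⟩ := mem_smul_graph.1 (hv j hj)
    obtain ⟨w', hw', hww'⟩ := mem_smul_graph.1 (hw j hj)
    rw [hvv', hww', inner_smul_left, inner_smul_right, conj_ofReal]
    exact congrArg _ (isSymmGraph_of_isSelfAdjoint (hX j) _ hv' _ hw')
  · refine (mem_sum_graph _ _ _ _).2 ⟨fun j => (l j : ℂ) • (x j φ : F),
      fun j _ => mem_smul_graph.2 ⟨_, hD.graph j φ, rfl⟩, by simp [LinearMap.sum_apply]⟩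

theorem IsCCRDomain.weylUnitary_eq (hX : ∀ j, IsSelfAdjoint (X j)) (hD : IsCCRDomain Θ X D x)
    (l : EuclideanSpace ℝ (Fin n)) : weylUnitary X l = expCLM (hD.isEntire hX l) 1 :=
  expI_eq_expCLM _ (hD.graph_linForm hX l)

theorem IsCCR.norm_weylUnitary (h : IsCCR Θ X) (l : EuclideanSpace ℝ (Fin n)) (φ : F) :
    ‖weylUnitary X l φ‖ = ‖φ‖ := by
  obtain ⟨hX, D, x, hD⟩ := h
  rw [hD.weylUnitary_eq hX, norm_expCLM]

/-- The adjoint is the group at time `-1`, whose series is that of `-y` at time `1`. -/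
theorem IsCCR.star_weylUnitary (h : IsCCR Θ X) (l : EuclideanSpace ℝ (Fin n)) :
    star (weylUnitary X l) = weylUnitary X (-l) := by
  obtain ⟨hX, D, x, hD⟩ := h
  rw [hD.weylUnitary_eq hX, hD.weylUnitary_eq hX, star_expCLM]
  refine ContinuousLinearMap.ext fun φ => ?_
  refine hD.dense.induction (P := fun φ => expCLM (hD.isEntire hX l) (-1) φ =
    expCLM (hD.isEntire hX (-l)) 1 φ) (fun φ hφ => ?_) (isClosed_eq (by fun_prop) (by fun_prop)) φ
  have : ∑ j, ((-l) j : ℂ) • x j = -∑ j, (l j : ℂ) • x j := by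
    rw [← Finset.sum_neg_distrib]
    refine Finset.sum_congr rfl fun j _ => ?_
    rw [PiLp.neg_apply, ofReal_neg]
    exact neg_smul (l j : ℂ) (x j)
  rw [expCLM_coe _ _ ⟨φ, hφ⟩, expCLM_coe _ _ ⟨φ, hφ⟩, this, expVec_neg]

theorem IsCCR.weylUnitary_mul_neg (h : IsCCR Θ X) (l : EuclideanSpace ℝ (Fin n)) :
    weylUnitary X l * weylUnitary X (-l) = 1 := by
  have h1 : star (weylUnitary X (-l)) * weylUnitary X (-l) = 1 :=
    (ContinuousLinearMap.norm_map_iff_adjoint_comp_self _).1 (h.norm_weylUnitary (-l))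
  rwa [h.star_weylUnitary, neg_neg] at h1

omit [CompleteSpace F] in
-- The vector is polynomial in the coordinates of `l`. Peeling off the rightmost factor changes `φ`
-- to `x k φ`, hence the induction over all vectors.
theorem continuous_linComb_pow (x : Fin n → Module.End ℂ D) (m : ℕ) (φ : D) :
    Continuous fun l : EuclideanSpace ℝ (Fin n) => (((∑ j, (l j : ℂ) • x j) ^ m) φ : F) := by
  induction m generalizing φ with
  | zero => simpa using continuous_const
  | succ m ih =>
    have : ∀ l : EuclideanSpace ℝ (Fin n), (((∑ j, (l j : ℂ) • x j) ^ (m + 1)) φ : F) =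
        ∑ k, (l k : ℂ) • (((∑ j, (l j : ℂ) • x j) ^ m) (x k φ) : F) := fun l => by
      rw [pow_succ, Module.End.mul_apply, LinearMap.sum_apply, map_sum, Submodule.coe_sum]
      simp only [LinearMap.smul_apply, map_smul, Submodule.coe_smul]
    simp only [this]
    exact continuous_finsetSum _ fun k _ => Continuous.smul (by fun_prop) (ih _)

/-- On `D` it is a pointwise limit of partial sums continuous in `l`; for general `φ`, a pointwise
limit along a sequence in `D`. -/
theorem IsCCR.stronglyMeasurable_weylUnitary (h : IsCCR Θ X) (φ : F) :
    StronglyMeasurable fun l => weylUnitary X l φ := by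
  obtain ⟨hX, D, x, hD⟩ := h
  have h1 : ∀ d : D, StronglyMeasurable fun l => weylUnitary X l d := fun d => by
    refine stronglyMeasurable_of_tendsto atTop (f := fun N (l : EuclideanSpace ℝ (Fin n)) =>
      ((∑ m ∈ Finset.range N, expTerm (∑ j, (l j : ℂ) • x j) 1 m d : D) : F)) (fun N => ?_)
      (tendsto_pi_nhds.2 fun l => ?_)
    · simp only [Submodule.coe_sum, expTerm, LinearMap.smul_apply, Submodule.coe_smul]
      exact (continuous_finsetSum _ fun m _ =>
        (continuous_linComb_pow x m d).const_smul _).stronglyMeasurable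
    · rw [hD.weylUnitary_eq hX, expCLM_coe]
      exact (hD.isEntire hX l).tendsto_expVec 1 d
  obtain ⟨s, hs, hs'⟩ := mem_closure_iff_seq_limit.1 (hD.dense φ)
  exact stronglyMeasurable_of_tendsto atTop (fun N => h1 ⟨s N, hs N⟩)
    (tendsto_pi_nhds.2 fun l => ((weylUnitary X l).continuous.tendsto φ).comp hs')

/-- The Weyl unitaries translate the position and momentum operators. -/
theorem IsCCR.weylUnitary_mem_graph (h : IsCCR Θ X) (l : EuclideanSpace ℝ (Fin n)) (j : Fin n)
    {φ ψ : F} (hφ : (φ, ψ) ∈ (X j).graph) :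
    (weylUnitary X l φ, weylUnitary X l (ψ - ((2 * ∑ k, Θ j k * l k : ℝ) : ℂ) • φ)) ∈
      (X j).graph := by
  obtain ⟨hX, D, x, hD⟩ := h
  set c : ℂ := ((2 * ∑ k, Θ j k * l k : ℝ) : ℂ) with hc
  have hG : (X j).graph = endGraph (x j) :=
    graph_eq_endGraph (hD.isEntire_single hX j) (hX j) (hD.graph j)
  rw [hG] at hφ ⊢
  let S : F × F →L[ℂ] F × F := ((weylUnitary X l).comp (ContinuousLinearMap.fst ℂ F F)).prod
    ((weylUnitary X l).comp (ContinuousLinearMap.snd ℂ F F - c • ContinuousLinearMap.fst ℂ F F))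
  have : endGraph (x j) ≤ (endGraph (x j)).comap S.toLinearMap := by
    refine endGraph_le ((Submodule.isClosed_topologicalClosure _).preimage S.continuous)
      fun d => ?_
    change (weylUnitary X l d, weylUnitary X l ((x j d : F) - c • (d : F))) ∈ endGraph (x j)
    -- Here `κ = i c`, so at time `1` the correction `κ i` equals `-c`.
    have hcomm : x j * (∑ k, (l k : ℂ) • x k) - (∑ k, (l k : ℂ) • x k) * x j =
        (I * c) • (1 : Module.End ℂ D) := by
      rw [hc, Finset.mul_sum, Finset.sum_mul, ← Finset.sum_sub_distrib]
      push_cast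
      rw [Finset.mul_sum, Finset.mul_sum, Finset.sum_smul]
      refine Finset.sum_congr rfl fun k _ => ?_
      rw [mul_smul_comm, smul_mul_assoc]
      refine (smul_sub (l k : ℂ) (x j * x k) (x k * x j)).symm.trans ?_
      rw [hD.ccr, smul_smul]
      congr 1
      ring
    have := (hD.isEntire hX l).expVec_mem_endGraph hcomm 1 d
    rw [hD.weylUnitary_eq hX, map_sub, map_smul, expCLM_coe, expCLM_coe]
    convert this using 2
    rw [sub_eq_add_neg, ← neg_smul]
    congr 2
    rw [ofReal_one]
    linear_combination (-c) * I_mul_I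
  exact this hφ

/-- Translation by `l` gives one inclusion of graphs and translation by `-l` the other, so the
domains agree too. -/
theorem IsCCR.conj_weylUnitary (h : IsCCR Θ X) (l : EuclideanSpace ℝ (Fin n)) (j : Fin n) :
    mul (mul (ofCLM (weylUnitary X l)) (X j)) (ofCLM (weylUnitary X (-l))) =
      X j + scalar ((2 * ∑ k, Θ j k * l k : ℝ) : ℂ) := by
  have hc : ((2 * ∑ k, Θ j k * (-l) k : ℝ) : ℂ) = -((2 * ∑ k, Θ j k * l k : ℝ) : ℂ) := by simp
  have h1 := fun φ ψ => h.weylUnitary_mem_graph (φ := φ) (ψ := ψ) l j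
  have h2 := fun φ ψ => h.weylUnitary_mem_graph (φ := φ) (ψ := ψ) (-l) j
  rw [hc] at h2
  set c : ℂ := ((2 * ∑ k, Θ j k * l k : ℝ) : ℂ)
  have h3 : ∀ φ, weylUnitary X l (weylUnitary X (-l) φ) = φ := fun φ =>
    congrArg (fun T : F →L[ℂ] F => T φ) (h.weylUnitary_mul_neg l)
  refine LinearPMap.eq_of_eq_graph ?_
  ext ⟨φ, ψ⟩
  simp only [mem_mul_graph, mem_add_graph, mem_ofCLM_graph, scalar]
  constructor
  · rintro ⟨_, rfl, a, ha, rfl⟩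
    have := h1 _ _ ha
    rw [map_sub, map_smul, h3] at this
    exact ⟨_, _, this, rfl, by simp⟩
  · rintro ⟨a, _, ha, rfl, rfl⟩
    refine ⟨_, rfl, _, h2 _ _ ha, ?_⟩
    rw [h3]
    simp

/-! ### Strong integrals of Weyl unitaries. -/

section Integrals

variable {μ : Measure (EuclideanSpace ℝ (Fin n))} {g : EuclideanSpace ℝ (Fin n) → ℂ}

theorem IsCCR.integrable_smul_weylUnitary (h : IsCCR Θ X) (hg : Integrable g μ) (φ : F) :
    Integrable (fun l => g l • weylUnitary X l φ) μ := by
  refine Integrable.mono' (hg.norm.mul_const ‖φ‖)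
    (hg.aestronglyMeasurable.smul (h.stronglyMeasurable_weylUnitary φ).aestronglyMeasurable) ?_
  exact Eventually.of_forall fun l => by rw [norm_smul, h.norm_weylUnitary]

theorem IsCCR.mem_weylInt_graph (h : IsCCR Θ X) (hg : Integrable g μ) (φ : F) :
    (φ, ∫ l, g l • weylUnitary X l φ ∂μ) ∈ (weylInt X μ g).graph :=
  mk_mem_graph_iff.2 ⟨h.integrable_smul_weylUnitary hg φ, rfl⟩

theorem IsCCR.exists_weylInt_eq_ofCLM (h : IsCCR Θ X) (hg : Integrable g μ) :
    ∃ T : F →L[ℂ] F, weylInt X μ g = ofCLM T ∧ ∀ φ, T φ = ∫ l, g l • weylUnitary X l φ ∂μ := by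
  let T : F →L[ℂ] F := LinearMap.mkContinuous
    { toFun := fun φ => ∫ l, g l • weylUnitary X l φ ∂μ
      map_add' := fun φ ψ => by
        simp only [map_add, smul_add]
        exact integral_add (h.integrable_smul_weylUnitary hg φ) (h.integrable_smul_weylUnitary hg ψ)
      map_smul' := fun c φ => by
        simp only [map_smul, smul_comm _ c, RingHom.id_apply]
        exact integral_smul c _ } (∫ l, ‖g l‖ ∂μ) fun φ => by
      refine (norm_integral_le_integral_norm _).trans_eq ?_
      simp only [norm_smul, h.norm_weylUnitary, integral_mul_const]
  exact ⟨T, eq_ofCLM (h.mem_weylInt_graph hg), fun _ => rfl⟩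

theorem IsCCR.isSelfAdjoint_weylInt [μ.IsNegInvariant] (h : IsCCR Θ X) (hg : Integrable g μ)
    (hg' : ∀ l, g (-l) = star (g l)) : IsSelfAdjoint (weylInt X μ g) := by
  obtain ⟨T, hT, hT'⟩ := h.exists_weylInt_eq_ofCLM hg
  rw [hT]
  refine isSelfAdjoint_ofCLM fun φ ψ => ?_
  rw [hT', hT', ← inner_conj_symm, ← integral_inner (h.integrable_smul_weylUnitary hg φ),
    ← integral_inner (h.integrable_smul_weylUnitary hg ψ), ← integral_conj,
    -- Reflecting `l` matches `U(l)* = U(-l)` with the conjugation symmetry of `g`.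
    ← integral_neg_eq_self (fun l => ⟪φ, g l • weylUnitary X l ψ⟫)]
  refine integral_congr_ae (Eventually.of_forall fun l => ?_)
  simp only
  rw [inner_conj_symm, inner_smul_left, inner_smul_right, hg', ← h.star_weylUnitary,
    ContinuousLinearMap.star_eq_adjoint, ContinuousLinearMap.adjoint_inner_right]
  rfl

theorem integrable_mul_coord {h : EuclideanSpace ℝ (Fin n) → ℂ} (hh : Integrable h μ)
    (hh' : Integrable (fun l => ‖l‖ * ‖h l‖) μ) (k : Fin n) :
    Integrable (fun l => h l * (l k : ℂ)) μ := by
  refine Integrable.mono' hh' (hh.aestronglyMeasurable.mul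
    (Continuous.aestronglyMeasurable (by fun_prop))) (Eventually.of_forall fun l => ?_)
  rw [norm_mul, norm_real, mul_comm]
  exact mul_le_mul_of_nonneg_right (PiLp.norm_apply_le l k) (norm_nonneg _)

end Integrals

end WeylOperators

/-! ### The commutator of `H₁` with `Xⱼ`. -/

section Drift

variable {F : Type*} [NormedAddCommGroup F] [InnerProductSpace ℂ F] [CompleteSpace F] {n : ℕ}
  {Θ : Matrix (Fin n) (Fin n) ℝ} {X : Fin n → F →ₗ.[ℂ] F}
  {μ : Measure (EuclideanSpace ℝ (Fin n))} {h : EuclideanSpace ℝ (Fin n) → ℂ}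

theorem IsCCR.exists_driftInt_eq_ofCLM (hX : IsCCR Θ X) (hint : Integrable h μ)
    (hint' : Integrable (fun l => ‖l‖ * ‖h l‖) μ) (j : Fin n) :
    ∃ T : F →L[ℂ] F, driftInt Θ X μ h j = ofCLM T ∧ ∀ φ, T φ =
      (2 * I) • ∑ k, (Θ j k : ℂ) • ∫ l, (h l * (l k : ℂ)) • weylUnitary X l φ ∂μ := by
  choose T hT hT' using fun k => hX.exists_weylInt_eq_ofCLM (integrable_mul_coord hint hint' k)
  refine ⟨(2 * I) • ∑ k, (Θ j k : ℂ) • T k, eq_ofCLM fun φ => ?_, fun φ => ?_⟩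
  · refine mem_smul_graph.2 ⟨_, (mem_sum_graph _ _ _ _).2 ⟨fun k => (Θ j k : ℂ) • T k φ,
      fun k _ => mem_smul_graph.2 ⟨_, ?_, rfl⟩, rfl⟩, ?_⟩
    · rw [hT]
      exact mem_ofCLM_graph.2 rfl
    · simp
  · simp [hT']

/-- The integral `∫ h(l) exp (i lᵀ X) dμ(l)` maps the domain of every `Xⱼ` into itself. -/
theorem IsCCR.integral_mem_graph (hX : IsCCR Θ X) (hint : Integrable h μ)
    (hint' : Integrable (fun l => ‖l‖ * ‖h l‖) μ) (j : Fin n) {φ ψ : F}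
    (hφ : (φ, ψ) ∈ (X j).graph) :
    (∫ l, h l • weylUnitary X l φ ∂μ, ∫ l, h l • weylUnitary X l ψ ∂μ -
      (2 : ℂ) • ∑ k, (Θ j k : ℂ) • ∫ l, (h l * (l k : ℂ)) • weylUnitary X l φ ∂μ) ∈
        (X j).graph := by
  have i1 := hX.integrable_smul_weylUnitary hint
  have i2 := fun k => hX.integrable_smul_weylUnitary (integrable_mul_coord hint hint' k) φ
  have i3 : ∀ k, Integrable (fun l => (Θ j k : ℂ) • (h l * (l k : ℂ)) • weylUnitary X l φ) μ :=
    fun k => (i2 k).smul (Θ j k : ℂ)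
  have i4 : Integrable (fun l => (2 : ℂ) • ∑ k, (Θ j k : ℂ) •
      (h l * (l k : ℂ)) • weylUnitary X l φ) μ :=
    (integrable_finsetSum _ fun k _ => i3 k).smul (2 : ℂ)
  have e : ∫ l, h l • weylUnitary X l ψ ∂μ -
      (2 : ℂ) • ∑ k, (Θ j k : ℂ) • ∫ l, (h l * (l k : ℂ)) • weylUnitary X l φ ∂μ =
      ∫ l, (h l • weylUnitary X l ψ -
        (2 : ℂ) • ∑ k, (Θ j k : ℂ) • (h l * (l k : ℂ)) • weylUnitary X l φ) ∂μ := by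
    rw [integral_sub (i1 ψ) i4, integral_smul, integral_finsetSum _ fun k _ => i3 k]
    simp only [integral_smul]
  have i5 : Integrable (fun l => h l • weylUnitary X l ψ -
      (2 : ℂ) • ∑ k, (Θ j k : ℂ) • (h l * (l k : ℂ)) • weylUnitary X l φ) μ := (i1 ψ).sub i4
  rw [e]
  -- Self-adjointness lets `Xⱼ` act on a test vector, so the claim reduces to the translation
  -- identity for each `l`, and no unbounded operator has to be moved inside the integral.
  refine mem_graph_of_isSelfAdjoint (hX.1 j) fun p hp => ?_
  rw [← integral_inner (i1 φ), ← integral_inner i5]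
  refine integral_congr_ae (Eventually.of_forall fun l => ?_)
  have key := isSymmGraph_of_isSelfAdjoint (hX.1 j) _ hp _ (hX.weylUnitary_mem_graph l j hφ)
  simp only at key ⊢
  rw [inner_smul_right, key, ← inner_smul_right]
  congr 1
  rw [map_sub, map_smul, smul_sub]
  congr 1
  push_cast
  rw [smul_smul, Finset.mul_sum, Finset.mul_sum, Finset.sum_smul, Finset.smul_sum]
  refine Finset.sum_congr rfl fun k _ => ?_
  rw [smul_smul, smul_smul]
  congr 1
  ring

/-- As `H₁` is everywhere defined and preserves `dom Xⱼ`, the commutator has exactly that domain;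
the terms `H₁ Xⱼ φ` cancel and only the translation term remains. -/
theorem IsCCR.mem_drift_graph (hX : IsCCR Θ X) (hint : Integrable h μ)
    (hint' : Integrable (fun l => ‖l‖ * ‖h l‖) μ) (j : Fin n) {φ ψ : F} :
    (φ, ψ) ∈ (drift (weylInt X μ h) X j).graph ↔ φ ∈ (X j).domain ∧ ψ =
      (2 * I) • ∑ k, (Θ j k : ℂ) • ∫ l, (h l * (l k : ℂ)) • weylUnitary X l φ ∂μ := by
  obtain ⟨T, hT, hT'⟩ := hX.exists_weylInt_eq_ofCLM hint
  have hm := fun φ ψ => hX.integral_mem_graph (φ := φ) (ψ := ψ) hint hint' j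
  simp only [← hT'] at hm
  simp only [drift, comm, mem_smul_graph, mem_sub_graph, mem_mul_graph, hT, mem_ofCLM_graph]
  constructor
  · rintro ⟨_, ⟨_, b, ⟨a, ha, rfl⟩, ⟨_, rfl, hb⟩, rfl⟩, rfl⟩
    refine ⟨LinearPMap.mem_domain_of_mem_graph ha, ?_⟩
    rw [(X j).mem_graph_snd_inj hb (hm _ _ ha) rfl, sub_sub_cancel, smul_smul, mul_comm]
  · rintro ⟨hφ, rfl⟩
    have ha := (X j).mem_graph ⟨φ, hφ⟩
    refine ⟨_, ⟨_, _, ⟨_, ha, rfl⟩, ⟨_, rfl, hm _ _ ha⟩, rfl⟩, ?_⟩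
    rw [sub_sub_cancel, smul_smul, mul_comm]

end Drift

end CCR

theorem mainTheorem6 {F : Type*} [NormedAddCommGroup F] [InnerProductSpace ℂ F] [CompleteSpace F]
    {n : ℕ} (Θ : Matrix (Fin n) (Fin n) ℝ) (hΘ : Θ.transpose = -Θ) (hdet : IsUnit Θ.det)
    (X : Fin n → F →ₗ.[ℂ] F) (hX : CCR.IsCCR Θ X)
    (μ : MeasureTheory.Measure (EuclideanSpace ℝ (Fin n))) [μ.IsNegInvariant]
    (h : EuclideanSpace ℝ (Fin n) → ℂ) (hh : ∀ l, h (-l) = star (h l))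
    (hint : MeasureTheory.Integrable h μ)
    (hint' : MeasureTheory.Integrable (fun l => ‖l‖ * ‖h l‖) μ) :
    (∀ (l : EuclideanSpace ℝ (Fin n)) (j : Fin n),
      CCR.mul (CCR.mul (CCR.ofCLM (CCR.weylUnitary X l)) (X j))
          (CCR.ofCLM (CCR.weylUnitary X (-l))) =
        X j + CCR.scalar ((2 * ∑ k, Θ j k * l k : ℝ) : ℂ)) ∧
    (CCR.weylInt X μ h).domain = ⊤ ∧
    IsSelfAdjoint (CCR.weylInt X μ h) ∧
    ∀ j : Fin n,
      (CCR.drift (CCR.weylInt X μ h) X j).domain = (X j).domain ∧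
      (CCR.driftInt Θ X μ h j).domain = ⊤ ∧
      CCR.drift (CCR.weylInt X μ h) X j ≤ CCR.driftInt Θ X μ h j ∧
      (CCR.drift (CCR.weylInt X μ h) X j).closure = CCR.driftInt Θ X μ h j := by
  refine ⟨hX.conj_weylUnitary, ?_, hX.isSelfAdjoint_weylInt hint hh, fun j => ?_⟩
  · obtain ⟨T, hT, -⟩ := hX.exists_weylInt_eq_ofCLM hint
    rw [hT]
    rfl
  obtain ⟨T, hT, hT'⟩ := hX.exists_driftInt_eq_ofCLM hint hint' j
  have hg := fun φ ψ => hX.mem_drift_graph (φ := φ) (ψ := ψ) hint hint' j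
  have hdom : (CCR.drift (CCR.weylInt X μ h) X j).domain = (X j).domain := by
    ext φ
    rw [LinearPMap.mem_domain_iff]
    exact ⟨fun ⟨ψ, hψ⟩ => ((hg φ ψ).1 hψ).1, fun hφ => ⟨_, (hg φ _).2 ⟨hφ, rfl⟩⟩⟩
  have hle : CCR.drift (CCR.weylInt X μ h) X j ≤ CCR.ofCLM T := by
    refine LinearPMap.le_of_le_graph ?_
    rintro ⟨φ, ψ⟩ hφ
    rw [CCR.mem_ofCLM_graph, hT']
    exact ((hg φ ψ).1 hφ).2
  rw [hT]
  exact ⟨hdom, rfl, hle, CCR.closure_eq_ofCLM (hdom ▸ (hX.1 j).dense_domain) hle⟩
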